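/- Let $(Q,+,\cdot,<)$ be an ordered field, let $B$ be a set (of bodies) with subsets $IOb$ (inertial observers) and $Ph$ (light signals), and let $W\subseteq B\times B\times Q^4$ be a relation; $W(o,b,\bar x)$ means that observer $o$ coordinatizes body $b$ at $\bar x=(x_1,x_2,x_3,x_4)$, where $x_4$ is the time coordinate. Put $$ev_o(\bar x)=\{b: W(o,b,\bar x)\},\qquad wline_o(b)=\{\bar x: W(o,b,\bar x)\},$$ $$dist(\bar x,\bar y)=\sqrt{(x_1-y_1)^2+(x_2-y_2)^2+(x_3-y_3)^2},\qquad time(\bar x,\bar y)=|x_4-y_4|,$$ and write $w_{oo'}(\bar x)=\bar x'$ if $ev_o(\bar x)=ev_{o'}(\bar x')$. If $wline_o(b)$ is contained in a line, we write $v_o(b)=v$ if there are distinct $\bar x,\bar y\in wline_o(b)$ with $dist(\bar x,\bar y)=v\cdot time(\bar x,\bar y)$. Assume $SpecRel_0$, that is: * $AxEField$: every positive element of $Q$ is a square; * $AxPh$: for every $i\in IOb$ there is $c_i\in Q$ such that for all $\bar x,\bar y\in Q^4$, some $p\in Ph$ satisfies $\bar x,\bar y\in wline_i(p)$ if and only if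 $dist(\bar x,\bar y)=c_i\cdot time(\bar x,\bar y)$; * $AxEv$: for all $i,i'\in IOb$ and $\bar x\in Q^4$ there is $\bar x'\in Q^4$ with $ev_i(\bar x)=ev_{i'}(\bar x')$; * $AxSelf$: for all $i\in IOb$, $\bar x\in wline_i(i)$ if and only if $x_1=x_2=x_3=0$. Assume moreover the two symmetry axioms: * $AxSymTime$: for all $i,i'\in IOb$ and $t\in Q$, $time\big(w_{ii'}(t\cdot\bar 1_t),w_{ii'}(\bar o)\big)=time\big(w_{i'i}(t\cdot\bar 1_t),w_{i'i}(\bar o)\big)$, where $\bar o=(0,0,0,0)$ and $\bar 1_t=(0,0,0,1)$ (for all values of the relations $w_{ii'}$, $w_{i'i}$ at these points); * $AxSymDist$: for all $i,i'\in IOb$ and $\bar x,\bar y,\bar x',\bar y'\in Q^4$ with $ev_i(\bar x)=ev_{i'}(\bar x')$, $ev_i(\bar y)=ev_{i'}(\bar y')$, $time(\bar x,\bar y)=0$ and $time(\bar x',\bar y')=0$, we have $dist(\bar x,\bar y)=dist(\bar x',\bar y')$. Then all inertial observers agree on the speed of light, $Ax(c_i=c_j)$: for all $i,j\in IOb$ and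 $p\in Ph$, $v_i(p)=v_j(p)$ whenever both speeds are defined. Moreover, one and the same $c\in Q$ can be taken as $c_i$ in $AxPh$ for all $i\in IOb$. -/

import Mathlib

/-- A structure for the two-sorted language of bodies `B` and quantities `Q`: the inertial
observers `IOb`, the light signals `Ph`, and the worldview relation, where `W o b x` says that
observer `o` coordinatizes body `b` at the coordinate point `x`. The coordinates `x 0, x 1, x 2`
are spatial and `x 3` is the time. -/
structure WorldviewModel (B Q : Type*) where
  IOb : Set B
  Ph : Set B
  W : B → B → (Fin 4 → Q) → Prop

namespace WorldviewModel

section Quantities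

variable {Q : Type*} [Field Q] [LinearOrder Q] [IsStrictOrderedRing Q]

open Classical in
/-- The nonnegative square root of `a` (with value `0` if there is none). -/
noncomputable def qsqrt (a : Q) : Q :=
  if h : ∃ r : Q, 0 ≤ r ∧ r ^ 2 = a then h.choose else 0

/-- Spatial distance of two coordinate points. -/
noncomputable def spaceDist (x y : Fin 4 → Q) : Q :=
  qsqrt ((x 0 - y 0) ^ 2 + (x 1 - y 1) ^ 2 + (x 2 - y 2) ^ 2)

/-- Time difference of two coordinate points. -/
def timeDiff (x y : Fin 4 → Q) : Q := |x 3 - y 3|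

end Quantities

variable {B Q : Type*} [Field Q] [LinearOrder Q] [IsStrictOrderedRing Q]

/-- The event coordinatized by `o` at `x`. -/
def ev (M : WorldviewModel B Q) (o : B) (x : Fin 4 → Q) : Set B := {b | M.W o b x}

/-- The worldline of `b` according to `o`. -/
def wline (M : WorldviewModel B Q) (o b : B) : Set (Fin 4 → Q) := {x | M.W o b x}

/-- The worldview transformation, a binary relation: `w_{oo'}(x) = x'`. -/
def wvt (M : WorldviewModel B Q) (o o' : B) (x x' : Fin 4 → Q) : Prop := M.ev o x = M.ev o' x'

/-- `v_o(b) = v`: the worldline of `b` according to `o` lies on a line, and `v` is the ratio of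
spatial distance and time difference for two distinct points of it. -/
def HasSpeed (M : WorldviewModel B Q) (o b : B) (v : Q) : Prop :=
  Collinear Q (M.wline o b) ∧
    ∃ x ∈ M.wline o b, ∃ y ∈ M.wline o b, x ≠ y ∧ spaceDist x y = v * timeDiff x y

/-- According to `i`, two coordinate points can be connected by a light signal exactly if the
corresponding speed is `c`. -/
def IsLightSpeed (M : WorldviewModel B Q) (i : B) (c : Q) : Prop :=
  ∀ x y : Fin 4 → Q,
    (∃ p ∈ M.Ph, x ∈ M.wline i p ∧ y ∈ M.wline i p) ↔ spaceDist x y = c * timeDiff x y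

def AxPh (M : WorldviewModel B Q) : Prop := ∀ i ∈ M.IOb, ∃ c : Q, M.IsLightSpeed i c

/-- The ordered field of quantities is Euclidean (that it is an ordered field is carried by the
type class arguments). -/
def AxEField (_M : WorldviewModel B Q) : Prop := ∀ a : Q, 0 < a → ∃ r : Q, a = r ^ 2

def AxEv (M : WorldviewModel B Q) : Prop :=
  ∀ i ∈ M.IOb, ∀ i' ∈ M.IOb, ∀ x : Fin 4 → Q, ∃ x' : Fin 4 → Q, M.ev i x = M.ev i' x'

def AxSelf (M : WorldviewModel B Q) : Prop :=
  ∀ i ∈ M.IOb, ∀ x : Fin 4 → Q, x ∈ M.wline i i ↔ x 0 = 0 ∧ x 1 = 0 ∧ x 2 = 0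

structure SpecRel₀ (M : WorldviewModel B Q) : Prop where
  axPh : M.AxPh
  axEField : M.AxEField
  axEv : M.AxEv
  axSelf : M.AxSelf

def AxSymDist (M : WorldviewModel B Q) : Prop :=
  ∀ i ∈ M.IOb, ∀ i' ∈ M.IOb, ∀ x y x' y' : Fin 4 → Q,
    M.ev i x = M.ev i' x' → M.ev i y = M.ev i' y' → timeDiff x y = 0 → timeDiff x' y' = 0 →
      spaceDist x y = spaceDist x' y'

/-- `timeDiff (w_{ii'}(t·1_t), w_{ii'}(o)) = timeDiff (w_{i'i}(t·1_t), w_{i'i}(o))` for all `t`, where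
`1_t = (0,0,0,1)` and `o` is the origin; `a, b` and `a', b'` are the values of the worldview
transformations. -/
def AxSymTime (M : WorldviewModel B Q) : Prop :=
  ∀ i ∈ M.IOb, ∀ i' ∈ M.IOb, ∀ t : Q, ∀ a b a' b' : Fin 4 → Q,
    M.wvt i i' (t • ![0, 0, 0, 1]) a → M.wvt i i' 0 b →
    M.wvt i' i (t • ![0, 0, 0, 1]) a' → M.wvt i' i 0 b' →
      timeDiff a b = timeDiff a' b'

/-- `v_i(p) = v_j(p)` for all inertial observers `i`, `j` and light signals `p`; a light signal
whose worldline has fewer than two points has no speed. -/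
def AxLightSpeedEq (M : WorldviewModel B Q) : Prop :=
  ∀ i ∈ M.IOb, ∀ j ∈ M.IOb, ∀ p ∈ M.Ph, ∀ v v' : Q,
    M.HasSpeed i p v → M.HasSpeed j p v' → v = v'

end WorldviewModel

/-!
If the light speeds `c` and `c'` of two observers are positive, then events determine coordinate
points, so the worldview transformation is a bijection `f` that preserves and reflects lightlike
separation. Such bijections are almost linear (Alexandrov–Zeeman): orthogonality to a null line can
be expressed by lightlike separation alone, so `f` takes parallel null lines to parallel null lines
and null parallelograms to null parallelograms; as null vectors generate the space, `f` is a
translation followed by an additive map `L`, and `L` transforms the Minkowski forms by an additive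
map `ψ` of the field.

Let `e` be the unit time vector and `L w = e`. A spatial vector `s` orthogonal to `w` has a spatial
image, and symmetry of distances then gives `ψ = id`, so that `L` is an isometry. The products of
`e` with `w` and of `L e` with `e` thus agree, that is, `c² w₄ = c'² (L e)₄`, whereas symmetry of
time says that `w₄` and `(L e)₄` have the same absolute value.

If `c ≤ 0`, then being connected by a light signal is a transitive relation, and for `c < 0` it is
equality; this lets all observers agree on the sign of `c`.
-/

open LinearMap (BilinForm)

section Symmetric

section CommRing

variable {K V : Type*} [CommRing K] [AddCommGroup V] [Module K V] {B : BilinForm K V}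

theorem bilinForm_sub_self (hB : B.IsSymm) (x y : V) :
    B (x - y) (x - y) = B x x - 2 * B x y + B y y := by
  simp only [map_sub, LinearMap.sub_apply, hB.eq y x]
  ring

theorem null_add_add (hB : B.IsSymm) {l m s : V} (hl : B l l = 0) (hm : B m m = 0)
    (hsl : B s l = 0) (hsm : B s m = 0) (h : 2 * B l m + B s s = 0) :
    B (l + m + s) (l + m + s) = 0 := by
  simp only [map_add, LinearMap.add_apply, hl, hm, hsl, hsm, hB.eq l s, hB.eq m s, hB.eq m l]
  linear_combination h

end CommRing

variable {K V : Type*} [Field K] [AddCommGroup V] [Module K V] {B : BilinForm K V}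

theorem null_sub_smul [NeZero (2 : K)] (hB : B.IsSymm) {l v : V} (hl : B l l = 0)
    (hlv : B l v ≠ 0) :
    B (v - (B v v / (2 * B l v)) • l) (v - (B v v / (2 * B l v)) • l) = 0 := by
  rw [bilinForm_sub_self hB]
  simp only [map_smul, LinearMap.smul_apply, smul_eq_mul, hl, hB.eq v l]
  field_simp
  ring

theorem exists_ne_zero_orthogonal_pair (B : BilinForm K V) (hV : 2 < Module.rank K V) (u v : V) :
    ∃ s ≠ 0, B s u = 0 ∧ B s v = 0 := by
  let φ : V →ₗ[K] Fin 2 → K := LinearMap.pi ![B.flip u, B.flip v]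
  have hφ : ¬ Function.Injective φ := fun h => by
    have hle := LinearMap.lift_rank_le_of_injective φ h
    rw [rank_fin_fun, Cardinal.lift_natCast, Nat.cast_ofNat, Cardinal.lift_le_ofNat_iff] at hle
    exact hle.not_gt hV
  rw [injective_iff_map_eq_zero] at hφ
  push Not at hφ
  obtain ⟨s, hs, hs0⟩ := hφ
  exact ⟨s, hs0, congrFun hs 0, congrFun hs 1⟩

end Symmetric

/-- A nondegenerate symmetric bilinear form of Witt index one, such as the Minkowski form: null
vectors exist, and orthogonal null vectors are parallel. -/
structure HasWittIndexOne {K V : Type*} [Field K] [AddCommGroup V] [Module K V]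
    (B : BilinForm K V) : Prop where
  isSymm : B.IsSymm
  nondegenerate : B.Nondegenerate
  exists_null : ∃ l ≠ 0, B l l = 0
  exists_eq_smul : ∀ ⦃l z : V⦄, l ≠ 0 → B l l = 0 → B z z = 0 → B l z = 0 → ∃ r : K, z = r • l

namespace HasWittIndexOne

variable {K V : Type*} [Field K] [AddCommGroup V] [Module K V] {B : BilinForm K V}

theorem exists_orthogonal_nonnull (hB : HasWittIndexOne B) (hV : 2 < Module.rank K V) {l m : V}
    (hl : B l l = 0) (hlm : B l m ≠ 0) : ∃ s, B s s ≠ 0 ∧ B s l = 0 ∧ B s m = 0 := by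
  obtain ⟨s, hs0, hsl, hsm⟩ := exists_ne_zero_orthogonal_pair B hV l m
  refine ⟨s, fun hs => ?_, hsl, hsm⟩
  have hl0 : l ≠ 0 := by rintro rfl; simp at hlm
  obtain ⟨r, rfl⟩ := hB.exists_eq_smul hl0 hl hs (hB.isSymm.eq s l ▸ hsl)
  have hr : r = 0 := by simpa [hlm] using hsm
  exact hs0 (by rw [hr, zero_smul])

variable [NeZero (2 : K)]

theorem exists_null_not_orthogonal (hB : HasWittIndexOne B) {l : V} (hl0 : l ≠ 0)
    (hl : B l l = 0) : ∃ m, B m m = 0 ∧ B l m ≠ 0 := by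
  obtain ⟨v, hv⟩ : ∃ v, B l v ≠ 0 := by
    by_contra! h
    exact hl0 (hB.nondegenerate.1 l h)
  exact ⟨_, null_sub_smul hB.isSymm hl hv, by simpa [hl] using hv⟩

/-- The null vectors that are not orthogonal to `l`. They generate the whole space additively, so
additive identities need only be checked on them. -/
def nullNotOrthogonal (B : BilinForm K V) (l : V) : Set V := {n | B n n = 0 ∧ B l n ≠ 0}

theorem smul_mem_closure_nullNotOrthogonal (hB : HasWittIndexOne B) (hV : 2 < Module.rank K V)
    {l : V} (hl0 : l ≠ 0) (hl : B l l = 0) (r : K) :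
    r • l ∈ AddSubmonoid.closure (nullNotOrthogonal B l) := by
  rcases eq_or_ne r 0 with rfl | hr
  · simp
  obtain ⟨m, hm, hlm⟩ := hB.exists_null_not_orthogonal hl0 hl
  obtain ⟨s, hs, hsl, hsm⟩ := hB.exists_orthogonal_nonnull hV hl hlm
  have hls : B l s = 0 := by rw [hB.isSymm.eq, hsl]
  obtain ⟨ρ, rfl⟩ : ∃ ρ, r = 2 * ρ := ⟨r / 2, (mul_div_cancel₀ r two_ne_zero).symm⟩
  obtain ⟨β, hβ⟩ : ∃ β, 2 * ρ * β * B l m = -B s s :=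
    ⟨-B s s / (2 * ρ * B l m),
      by rw [mul_right_comm, mul_div_cancel₀ _ (mul_ne_zero hr hlm)]⟩
  have hβ0 : β ≠ 0 := by
    rintro rfl
    simp [hs] at hβ
  have hmem : ∀ t, B t t = B s s → B t l = 0 → B t m = 0 → B l t = 0 →
      ρ • l + β • m + t ∈ nullNotOrthogonal B l := fun t ht htl htm hlt => by
    refine ⟨null_add_add hB.isSymm ?_ ?_ ?_ ?_ ?_, ?_⟩ <;>
      simp only [map_add, map_smul, LinearMap.smul_apply, smul_eq_mul, hl, hm, htl, htm, hlt, ht,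
        mul_zero, add_zero, zero_add]
    · linear_combination hβ
    · exact mul_ne_zero hβ0 hlm
  have hdecomp : (2 * ρ) • l =
      (ρ • l + β • m + s) + (ρ • l + β • m + -s) + (-2 * β) • m := by module
  rw [hdecomp]
  refine add_mem (add_mem ?_ ?_) ?_ <;> refine AddSubmonoid.subset_closure ?_
  · exact hmem s rfl hsl hsm hls
  · exact hmem (-s) (by simp) (by simpa using hsl) (by simpa using hsm) (by simpa using hls)
  · exact ⟨by simp [hm], by simpa [hβ0, NeZero.ne] using hlm⟩

theorem closure_nullNotOrthogonal (hB : HasWittIndexOne B) (hV : 2 < Module.rank K V)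
    {l : V} (hl0 : l ≠ 0) (hl : B l l = 0) :
    AddSubmonoid.closure (nullNotOrthogonal B l) = ⊤ := by
  have hmem : ∀ v, B l v ≠ 0 → v ∈ AddSubmonoid.closure (nullNotOrthogonal B l) := fun v hv => by
    rw [← sub_add_cancel v ((B v v / (2 * B l v)) • l)]
    exact add_mem (AddSubmonoid.subset_closure
      ⟨null_sub_smul hB.isSymm hl hv, by simpa [hl] using hv⟩)
      (hB.smul_mem_closure_nullNotOrthogonal hV hl0 hl _)
  refine eq_top_iff.2 fun v _ => ?_
  by_cases hv : B l v = 0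
  · obtain ⟨m, -, hlm⟩ := hB.exists_null_not_orthogonal hl0 hl
    rw [← add_neg_cancel_right v m]
    exact add_mem (hmem _ (by simpa [hv] using hlm)) (hmem _ (by simpa using hlm))
  · exact hmem v hv

theorem orthogonal_iff_forall_null (hB : HasWittIndexOne B) {a v : V} (ha0 : a ≠ 0)
    (ha : B a a = 0) :
    B a v = 0 ↔ ∀ p, B p p = 0 → B (p - a) (p - a) = 0 → B (p - v) (p - v) = 0 →
      B v v = 0 ∧ B (v - a) (v - a) = 0 := by
  have hsmul : ∀ r : K, B (r • a) (r • a) = 0 := by simp [ha]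
  have horth : ∀ {p}, B p p = 0 → B (p - a) (p - a) = 0 → B a p = 0 := fun hp hpa => by
    rw [bilinForm_sub_self hB.isSymm, hp, ha, hB.isSymm.eq] at hpa
    simpa [NeZero.ne] using hpa
  constructor
  · intro hv p hp hpa hpv
    obtain ⟨r, rfl⟩ := hB.exists_eq_smul ha0 ha hp (horth hp hpa)
    obtain ⟨s, hs⟩ := hB.exists_eq_smul ha0 ha hpv (by simp [ha, hv])
    have hvr : v = (r - s) • a := by rw [sub_smul, ← hs, sub_sub_cancel]
    have hva : v - a = (r - s - 1) • a := by rw [sub_smul, one_smul, ← hvr]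
    exact ⟨hvr ▸ hsmul _, hva ▸ hsmul _⟩
  · intro h
    by_contra hv
    obtain ⟨r, hr⟩ : ∃ r : K, r = B v v / (2 * B a v) := ⟨_, rfl⟩
    have hrv : B (r • a - v) (r • a - v) = 0 := by
      rw [← neg_sub v, map_neg, map_neg, LinearMap.neg_apply, neg_neg, hr]
      exact null_sub_smul hB.isSymm ha hv
    have hra : B (r • a - a) (r • a - a) = 0 := by
      rw [show r • a - a = (r - 1) • a by rw [sub_smul, one_smul]]
      exact hsmul _
    obtain ⟨hvv, hva⟩ := h _ (hsmul r) hra hrv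
    exact hv (horth hvv hva)

end HasWittIndexOne

/-- Lightlike separation of two points with respect to the form `B`. The bijections that preserve
and reflect it are the relation isomorphisms `NullSep B ≃r NullSep B'`. -/
def NullSep {K V : Type*} [CommRing K] [AddCommGroup V] [Module K V] (B : BilinForm K V)
    (x y : V) : Prop :=
  B (y - x) (y - x) = 0

namespace NullSep

theorem self_add_iff {K V : Type*} [CommRing K] [AddCommGroup V] [Module K V]
    {B : BilinForm K V} {x a : V} : NullSep B x (x + a) ↔ B a a = 0 := by
  rw [NullSep, add_sub_cancel_left]

section Causal

variable {K V : Type*} [Field K] [AddCommGroup V] [Module K V] {B : BilinForm K V}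
  [NeZero (2 : K)]

theorem eq_of_forall_iff (hB : HasWittIndexOne B) {x y : V}
    (h : ∀ z, NullSep B x z ↔ NullSep B y z) : x = y := by
  have hxy : B (y - x) (y - x) = 0 := (h y).2 (by simp [NullSep])
  by_contra hne
  obtain ⟨m, hm, hxm⟩ := hB.exists_null_not_orthogonal (sub_ne_zero.2 (Ne.symm hne)) hxy
  have hmx : B (y - x - -m) (y - x - -m) = 0 := by
    rw [sub_neg_eq_add, sub_add_eq_add_sub]
    exact (h (y + m)).2 (self_add_iff.2 hm)
  rw [bilinForm_sub_self hB.isSymm, hxy, map_neg] at hmx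
  simp [NeZero.ne, hm, -map_sub, -LinearMap.sub_apply, hxm] at hmx

/-- The null hyperplane through the null line `xy` consists of the points on this line and the
points not lightlike separated from any point of it. -/
theorem orthogonal_iff_forall (hB : HasWittIndexOne B) {x y z : V} (hne : x ≠ y)
    (hxy : NullSep B x y) :
    B (y - x) (z - x) = 0 ↔
      ∀ p, NullSep B x p → NullSep B y p → NullSep B z p → NullSep B x z ∧ NullSep B y z := by
  rw [hB.orthogonal_iff_forall_null (sub_ne_zero.2 hne.symm) hxy,
    ← (Equiv.subRight x).forall_congr_right]
  simp only [NullSep, Equiv.subRight_apply, sub_sub_sub_cancel_right]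

end Causal

section Images

variable {K K' V V' : Type*} [Field K] [NeZero (2 : K)] [AddCommGroup V] [Module K V]
  [Field K'] [NeZero (2 : K')] [AddCommGroup V'] [Module K' V']
  {B : BilinForm K V} {B' : BilinForm K' V'}

theorem orthogonal_image_iff (hB : HasWittIndexOne B) (hB' : HasWittIndexOne B')
    (f : NullSep B ≃r NullSep B') {x y z : V} (hne : x ≠ y) (hxy : NullSep B x y) :
    B (y - x) (z - x) = 0 ↔ B' (f y - f x) (f z - f x) = 0 := by
  rw [orthogonal_iff_forall hB hne hxy,
    orthogonal_iff_forall hB' (f.injective.ne hne) (f.map_rel_iff.2 hxy),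
    ← f.toEquiv.forall_congr_right]
  simp only [RelIso.coe_fn_toEquiv, f.map_rel_iff]

theorem parallel_image (hB : HasWittIndexOne B) (hB' : HasWittIndexOne B')
    (f : NullSep B ≃r NullSep B') (x z : V) {a : V} (ha0 : a ≠ 0) (ha : B a a = 0) :
    ∃ r : K', f (z + a) - f z = r • (f (x + a) - f x) := by
  have himage : ∀ y v, B a (v - y) = 0 ↔ B' (f (y + a) - f y) (f v - f y) = 0 := fun y v => by
    rw [← orthogonal_image_iff hB hB' f (by simpa using ha0) (self_add_iff.2 ha),
      add_sub_cancel_left]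
  have hnull : ∀ y, B' (f (y + a) - f y) (f (y + a) - f y) = 0 := fun y =>
    f.map_rel_iff.2 (self_add_iff.2 ha)
  refine hB'.exists_eq_smul (sub_ne_zero.2 (f.injective.ne (by simpa using ha0))) (hnull x)
    (hnull z) ?_
  by_contra hXZ
  obtain ⟨X, hX⟩ : ∃ X, X = f (x + a) - f x := ⟨_, rfl⟩
  obtain ⟨Z, hZ⟩ : ∃ Z, Z = f (z + a) - f z := ⟨_, rfl⟩
  rw [← hX, ← hZ, hB'.isSymm.eq] at hXZ
  -- The image hyperplanes through `f x` and `f z` have a common point, so the parallel hyperplanes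
  -- orthogonal to `a` through `x` and `z` meet and therefore coincide.
  obtain ⟨p, hp⟩ := f.surjective (f x + (B' Z (f z - f x) / B' Z X) • X)
  have hpx : B a (p - x) = 0 := by
    rw [himage, hp, add_sub_cancel_left, map_smul, hX, hnull, smul_zero]
  have hpz : B a (p - z) = 0 := by
    rw [himage, hp, ← hZ, add_sub_right_comm, ← neg_sub (f z), map_add, map_neg, map_smul,
      smul_eq_mul, div_mul_cancel₀ _ hXZ, neg_add_cancel]
  have hzx : B a (z - x) = 0 := by
    rw [← sub_sub_sub_cancel_left x z p, map_sub, hpx, hpz, sub_zero]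
  have hzax : B a (z + a - x) = 0 := by rw [add_sub_right_comm, map_add, hzx, ha, add_zero]
  refine hXZ ?_
  have hZ' : Z = (f (z + a) - f x) - (f z - f x) := by rw [hZ, sub_sub_sub_cancel_right]
  rw [hB'.isSymm.eq, hZ', hX, map_sub, (himage x _).1 hzx, (himage x _).1 hzax, sub_zero]

theorem image_add_of_not_orthogonal (hB : HasWittIndexOne B) (hB' : HasWittIndexOne B')
    (f : NullSep B ≃r NullSep B') {a b : V} (ha : B a a = 0) (hb : B b b = 0) (hab : B a b ≠ 0)
    (x : V) : f (x + b + a) - f (x + b) = f (x + a) - f x := by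
  have ha0 : a ≠ 0 := by rintro rfl; simp at hab
  have hb0 : b ≠ 0 := by rintro rfl; simp at hab
  obtain ⟨r, hr⟩ := parallel_image hB hB' f x (x + b) ha0 ha
  obtain ⟨s, hs⟩ := parallel_image hB hB' f x (x + a) hb0 hb
  have hbb : B' (f (x + b) - f x) (f (x + b) - f x) = 0 := f.map_rel_iff.2 (self_add_iff.2 hb)
  have hba : B' (f (x + b) - f x) (f (x + a) - f x) ≠ 0 := by
    rwa [Ne, ← orthogonal_image_iff hB hB' f (by simpa using hb0) (self_add_iff.2 hb),
      add_sub_cancel_left, add_sub_cancel_left, hB.isSymm.eq]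
  have hparallel : (r - 1) • (f (x + a) - f x) = (s - 1) • (f (x + b) - f x) := by
    rw [sub_smul, sub_smul, ← hr, ← hs, add_right_comm x a b]
    module
  have hr1 : r - 1 = 0 := by
    have h := congrArg (B' (f (x + b) - f x)) hparallel
    rw [map_smul, map_smul, hbb, smul_zero] at h
    exact (smul_eq_zero.1 h).resolve_right hba
  rw [hr, sub_eq_zero.1 hr1, one_smul]

theorem image_add_of_null (hB : HasWittIndexOne B) (hB' : HasWittIndexOne B')
    (hV : 2 < Module.rank K V) (f : NullSep B ≃r NullSep B') {a : V} (ha : B a a = 0) (b x : V) :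
    f (x + b + a) - f (x + b) = f (x + a) - f x := by
  rcases eq_or_ne a 0 with rfl | ha0
  · simp
  have hb : b ∈ AddSubmonoid.closure (HasWittIndexOne.nullNotOrthogonal B a) := by
    rw [hB.closure_nullNotOrthogonal hV ha0 ha]
    trivial
  induction hb using AddSubmonoid.closure_induction generalizing x with
  | mem b hb => exact image_add_of_not_orthogonal hB hB' f ha hb.1 hb.2 x
  | zero => rw [add_zero]
  | add b c _ _ ihb ihc => rw [← add_assoc, ihc, ihb]

theorem image_add_sub_image (hB : HasWittIndexOne B) (hB' : HasWittIndexOne B')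
    (hV : 2 < Module.rank K V) (f : NullSep B ≃r NullSep B') (x y : V) :
    f (x + y) - f x = f y - f 0 := by
  obtain ⟨l, hl0, hl⟩ := hB.exists_null
  have hy : y ∈ AddSubmonoid.closure (HasWittIndexOne.nullNotOrthogonal B l) := by
    rw [hB.closure_nullNotOrthogonal hV hl0 hl]
    trivial
  induction hy using AddSubmonoid.closure_induction generalizing x with
  | mem a ha => simpa using image_add_of_null hB hB' hV f ha.1 x 0
  | zero => simp
  | add a b _ _ iha ihb =>
    rw [← add_assoc, ← sub_add_sub_cancel (f (x + a + b)) (f (x + a)), ihb, iha,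
      ← sub_add_sub_cancel (f (a + b)) (f a), ihb]

theorem exists_addMonoidHom (hB : HasWittIndexOne B) (hB' : HasWittIndexOne B')
    (hV : 2 < Module.rank K V) (f : NullSep B ≃r NullSep B') :
    ∃ L : V →+ V', ∀ x, L x = f x - f 0 :=
  ⟨AddMonoidHom.mk' (fun x => f x - f 0) fun x y => by
    rw [← sub_add_sub_cancel _ (f x), image_add_sub_image hB hB' hV, add_comm], fun _ => rfl⟩

end Images

end NullSep

theorem addMonoidHom_ext_mul_sq {K A : Type*} [Field K] [NeZero (2 : K)] [AddCommGroup A]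
    {φ ψ : K →+ A} {k : K} (hk : k ≠ 0) (h : ∀ t, φ (k * t ^ 2) = ψ (k * t ^ 2)) : φ = ψ := by
  ext x
  have hx : x = k * ((x / k + 1) / 2) ^ 2 - k * ((x / k - 1) / 2) ^ 2 := by
    have h2 : (2 : K) ≠ 0 := two_ne_zero
    field_simp
    ring
  rw [hx, map_sub, map_sub, h, h]

namespace HasWittIndexOne

variable {K V A : Type*} [Field K] [AddCommGroup V] [Module K V] [AddCommGroup A]
  {B : BilinForm K V} {G : V →+ V →+ A}

theorem map_smul_comm_of_add_null (hBs : B.IsSymm) (hGs : ∀ x y, G x y = G y x)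
    (hG : ∀ l z, B l l = 0 → B l z = 0 → G l z = 0) {l m s : V} (hl : B l l = 0) (hm : B m m = 0)
    (hsl : B s l = 0) (hsm : B s m = 0) (h : 2 * B l m + B s s = 0) (q : K) :
    G m (q • l) = G l (q • m) := by
  have hself : ∀ {n}, B n n = 0 → G n (q • n) = 0 := fun hn => hG _ _ hn (by simp [hn])
  have horth : ∀ {n}, B n n = 0 → B s n = 0 → G s (q • n) = 0 := fun hn hsn => by
    rw [hGs]
    exact hG _ _ (by simp [hn]) (by simp [hBs.eq _ s, hsn])
  have hnull := hG _ (q • l - q • m) (null_add_add hBs hl hm hsl hsm h)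
    (by simp [hl, hm, hsl, hsm, hBs.eq m l])
  simp only [map_add, map_sub, AddMonoidHom.add_apply, hself hl, hself hm, horth hl hsl,
    horth hm hsm] at hnull
  rw [← sub_eq_zero, ← hnull]
  abel

variable [NeZero (2 : K)]

theorem map_smul_comm_of_null (hB : HasWittIndexOne B) (hV : 2 < Module.rank K V)
    (hGs : ∀ x y, G x y = G y x) (hG : ∀ l z, B l l = 0 → B l z = 0 → G l z = 0) {l m : V}
    (hl : B l l = 0) (hm : B m m = 0) (hlm : B l m ≠ 0) (q : K) :
    G m (q • l) = G l (q • m) := by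
  obtain ⟨s, hs, hsl, hsm⟩ := hB.exists_orthogonal_nonnull hV hl hlm
  let φ : K →+ A := AddMonoidHom.mk' (fun x => G m (q • x • l)) fun x y => by
    rw [add_smul, smul_add, map_add]
  let ψ : K →+ A := AddMonoidHom.mk' (fun x => G (x • l) (q • m)) fun x y => by
    rw [add_smul, map_add, AddMonoidHom.add_apply]
  have h2lm : 2 * B l m ≠ 0 := mul_ne_zero two_ne_zero hlm
  -- The vectors `t • s` serve the multiples of `l` by `k t²`, with `k` fixed.
  have hφψ : φ = ψ := addMonoidHom_ext_mul_sq (div_ne_zero (neg_ne_zero.2 hs) h2lm) fun t =>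
    map_smul_comm_of_add_null hB.isSymm hGs hG (s := t • s) (by simp [hl]) hm (by simp [hsl])
      (by simp [hsm]) (by
        simp only [map_smul, LinearMap.smul_apply, smul_eq_mul]
        field_simp
        ring) q
  simpa [φ, ψ] using DFunLike.congr_fun hφψ 1

theorem exists_map_eq (hB : HasWittIndexOne B) (hV : 2 < Module.rank K V)
    (hGs : ∀ x y, G x y = G y x) (hG : ∀ l z, B l l = 0 → B l z = 0 → G l z = 0) :
    ∃ ψ : K →+ A, ∀ x y, G x y = ψ (B x y) := by
  obtain ⟨l, hl0, hl⟩ := hB.exists_null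
  obtain ⟨m, -, hlm⟩ := hB.exists_null_not_orthogonal hl0 hl
  let ψ : K →+ A := AddMonoidHom.mk' (fun q => G l ((q / B l m) • m)) fun x y => by
    rw [add_div, add_smul, map_add]
  have hcongr : ∀ n y z, B n n = 0 → B n y = B n z → G n y = G n z := fun n y z hn hyz => by
    rw [← sub_eq_zero, ← map_sub]
    exact hG _ _ hn (by rw [map_sub, hyz, sub_self])
  have hnull : ∀ y n, B n n = 0 → B l n ≠ 0 → G n y = ψ (B n y) := fun y n hn hln => calc
    G n y = G n ((B n y / B n l) • l) := hcongr _ _ _ hn (by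
      rw [map_smul, smul_eq_mul, div_mul_cancel₀ _ (hB.isSymm.eq l n ▸ hln)])
    _ = G l ((B n y / B n l) • n) := hB.map_smul_comm_of_null hV hGs hG hl hn hln _
    _ = ψ (B n y) := hcongr _ _ _ hl (by
      rw [map_smul, map_smul, smul_eq_mul, smul_eq_mul, div_mul_cancel₀ _ hlm, hB.isSymm.eq l n,
        div_mul_cancel₀ _ (hB.isSymm.eq l n ▸ hln)])
  refine ⟨ψ, fun x y => ?_⟩
  have hext : G.flip y = ψ.comp (B.flip y).toAddMonoidHom :=
    AddMonoidHom.eq_of_eqOn_denseM (hB.closure_nullNotOrthogonal hV hl0 hl)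
      fun n hn => hnull y n hn.1 hn.2
  exact DFunLike.congr_fun hext x

end HasWittIndexOne

namespace NullSep

/-- The Alexandrov–Zeeman theorem. -/
theorem exists_similarity {K K' V V' : Type*} [Field K] [NeZero (2 : K)] [AddCommGroup V]
    [Module K V] [Field K'] [NeZero (2 : K')] [AddCommGroup V'] [Module K' V']
    {B : BilinForm K V} {B' : BilinForm K' V'} (hB : HasWittIndexOne B)
    (hB' : HasWittIndexOne B') (hV : 2 < Module.rank K V) (f : NullSep B ≃r NullSep B') :
    ∃ (L : V →+ V') (ψ : K →+ K'),
      (∀ x, L x = f x - f 0) ∧ ∀ x y, B' (L x) (L y) = ψ (B x y) := by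
  obtain ⟨L, hL⟩ := exists_addMonoidHom hB hB' hV f
  let G : V →+ V →+ K' := AddMonoidHom.mk' (fun x => (B' (L x)).toAddMonoidHom.comp L)
    fun x y => by ext z; simp
  have hG : ∀ l z, B l l = 0 → B l z = 0 → G l z = 0 := fun l z hl hlz => by
    rcases eq_or_ne l 0 with rfl | hl0
    · rw [map_zero, AddMonoidHom.zero_apply]
    · have h := orthogonal_image_iff hB hB' f hl0.symm (z := z) (by simpa [NullSep] using hl)
      simpa [G, hL, hlz] using h
  obtain ⟨ψ, hψ⟩ := hB.exists_map_eq hV (fun x y => hB'.isSymm.eq _ _) hG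
  exact ⟨L, ψ, hL, hψ⟩

end NullSep

theorem HasWittIndexOne.of_anisotropic_ker {K V : Type*} [Field K] [AddCommGroup V] [Module K V]
    {B : BilinForm K V} (hs : B.IsSymm) (hn : B.Nondegenerate) (hnull : ∃ l ≠ 0, B l l = 0)
    (τ : V →ₗ[K] K) (hτ : ∀ x, τ x = 0 → B x x = 0 → x = 0) : HasWittIndexOne B := by
  refine ⟨hs, hn, hnull, fun l z hl0 hl hz hlz => ⟨τ z / τ l, sub_eq_zero.1 (hτ _ ?_ ?_)⟩⟩
  · rw [map_sub, map_smul, smul_eq_mul, div_mul_cancel₀ _ fun h => hl0 (hτ l h hl), sub_self]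
  · rw [bilinForm_sub_self hs]
    simp [hl, hz, hs.eq z l, hlz]

/-- The Minkowski form on `Q⁴` with speed of light `c`; the last coordinate is the time. -/
def minkowskiForm {Q : Type*} [CommRing Q] (c : Q) : BilinForm Q (Fin 4 → Q) :=
  Matrix.toBilin' (Matrix.diagonal ![1, 1, 1, -c ^ 2])

section MinkowskiForm

section CommRing

variable {Q : Type*} [CommRing Q] {c : Q}

theorem minkowskiForm_apply (c : Q) (x y : Fin 4 → Q) :
    minkowskiForm c x y = x 0 * y 0 + x 1 * y 1 + x 2 * y 2 - c ^ 2 * (x 3 * y 3) := by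
  simp only [minkowskiForm, Matrix.toBilin'_apply', dotProduct, Matrix.mulVec_diagonal,
    Fin.sum_univ_four, Matrix.cons_val]
  ring

theorem minkowskiForm_time (c : Q) (x : Fin 4 → Q) :
    minkowskiForm c x ![0, 0, 0, 1] = -c ^ 2 * x 3 := by
  simp [minkowskiForm_apply]

theorem two_lt_rank_fin_four [Nontrivial Q] : 2 < Module.rank Q (Fin 4 → Q) := by
  rw [rank_fin_fun]
  norm_num

variable [LinearOrder Q] [IsStrictOrderedRing Q]

theorem minkowskiForm_self_pos {x : Fin 4 → Q} (hx3 : x 3 = 0) (hx : x ≠ 0) :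
    0 < minkowskiForm c x x := by
  have hform : minkowskiForm c x x = x 0 * x 0 + x 1 * x 1 + x 2 * x 2 := by
    simp [minkowskiForm_apply, hx3]
  rw [hform]
  refine lt_of_le_of_ne (by nlinarith) fun h => hx ?_
  have h0 : x 0 = 0 := by nlinarith
  have h1 : x 1 = 0 := by nlinarith
  have h2 : x 2 = 0 := by nlinarith
  ext i
  fin_cases i
  exacts [h0, h1, h2, hx3]

end CommRing

theorem hasWittIndexOne_minkowskiForm {Q : Type*} [Field Q] [LinearOrder Q]
    [IsStrictOrderedRing Q] {c : Q} (hc : c ≠ 0) : HasWittIndexOne (minkowskiForm c) := by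
  refine .of_anisotropic_ker ⟨fun x y => ?_⟩ ?_ ⟨![c, 0, 0, 1], ?_, ?_⟩ (LinearMap.proj 3)
    fun x hx3 hx => ?_
  · simp only [minkowskiForm_apply]
    ring
  · exact LinearMap.BilinForm.nondegenerate_toBilin'_of_det_ne_zero' _
      (by simp [Matrix.det_diagonal, Fin.prod_univ_four, hc])
  · simp
  · simp [minkowskiForm_apply, sq]
  · by_contra hne
    exact (minkowskiForm_self_pos hx3 hne).ne' hx

end MinkowskiForm

section SpeedOfLight

variable {Q : Type*} [Field Q] [LinearOrder Q] [IsStrictOrderedRing Q] {c c' : Q}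

theorem exists_addMonoidHom_minkowskiForm_eq (hc : c ≠ 0) (hc' : c' ≠ 0)
    (f : NullSep (minkowskiForm c) ≃r NullSep (minkowskiForm c'))
    (hD : ∀ x, x 3 = 0 → f x 3 = f 0 3 →
      minkowskiForm c' (f x - f 0) (f x - f 0) = minkowskiForm c x x) :
    ∃ L : (Fin 4 → Q) →+ (Fin 4 → Q), (∀ x, L x = f x - f 0) ∧
      ∀ x y, minkowskiForm c' (L x) (L y) = minkowskiForm c x y := by
  obtain ⟨L, ψ, hL, hψ⟩ := NullSep.exists_similarity (hasWittIndexOne_minkowskiForm hc)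
    (hasWittIndexOne_minkowskiForm hc') two_lt_rank_fin_four f
  obtain ⟨w, hw⟩ : ∃ w, L w = ![0, 0, 0, 1] :=
    ⟨f.symm (f 0 + ![0, 0, 0, 1]), by rw [hL, f.apply_symm_apply, add_sub_cancel_left]⟩
  obtain ⟨s, hs0, hse, hsw⟩ :=
    exists_ne_zero_orthogonal_pair (minkowskiForm c) two_lt_rank_fin_four ![0, 0, 0, 1] w
  have hs3 : s 3 = 0 := by simpa [minkowskiForm_time, hc] using hse
  have hLs3 : ∀ r : Q, L (r • s) 3 = 0 := fun r => by
    have h : minkowskiForm c' (L (r • s)) (L w) = 0 := by simp [hψ, hsw]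
    simpa [hw, minkowskiForm_time, hc'] using h
  have hψid : ψ = AddMonoidHom.id Q :=
    addMonoidHom_ext_mul_sq (minkowskiForm_self_pos (c := c) hs3 hs0).ne' fun r => by
      have hrs : minkowskiForm c (r • s) (r • s) = minkowskiForm c s s * r ^ 2 := by
        simp only [map_smul, LinearMap.smul_apply, smul_eq_mul]
        ring
      have h := hD (r • s) (by simp [hs3]) (sub_eq_zero.1 (by simpa [hL] using hLs3 r))
      rwa [← hL, hψ, hrs] at h
  exact ⟨L, hL, fun x y => by rw [hψ, hψid, AddMonoidHom.id_apply]⟩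

theorem sq_eq_sq_of_nullSep_relIso (hc : c ≠ 0) (hc' : c' ≠ 0)
    (f : NullSep (minkowskiForm c) ≃r NullSep (minkowskiForm c'))
    (hD : ∀ x, x 3 = 0 → f x 3 = f 0 3 →
      minkowskiForm c' (f x - f 0) (f x - f 0) = minkowskiForm c x x)
    (hT : |f ![0, 0, 0, 1] 3 - f 0 3| = |f.symm ![0, 0, 0, 1] 3 - f.symm 0 3|) :
    c ^ 2 = c' ^ 2 := by
  obtain ⟨L, hL, hiso⟩ := exists_addMonoidHom_minkowskiForm_eq hc hc' f hD
  obtain ⟨w, hw⟩ : ∃ w, w = f.symm ![0, 0, 0, 1] - f.symm 0 := ⟨_, rfl⟩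
  have hLw : L w = ![0, 0, 0, 1] := by
    rw [hw, map_sub, hL, hL, f.apply_symm_apply, f.apply_symm_apply, sub_sub_sub_cancel_right,
      sub_zero]
  have hw3 : w 3 ≠ 0 := fun h => by
    have hw0 : w ≠ 0 := by
      rintro rfl
      simpa using congrFun hLw 3
    have hself : minkowskiForm c w w = -c' ^ 2 := by
      rw [← hiso, hLw, minkowskiForm_time]
      simp
    exact (neg_nonpos.2 (sq_nonneg c')).not_gt (hself ▸ minkowskiForm_self_pos h hw0)
  have hdual : c' ^ 2 * (f ![0, 0, 0, 1] 3 - f 0 3) = c ^ 2 * w 3 := by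
    have h := hiso ![0, 0, 0, 1] w
    rw [hLw, minkowskiForm_time, (hasWittIndexOne_minkowskiForm hc).isSymm.eq,
      minkowskiForm_time, hL, Pi.sub_apply] at h
    linear_combination -h
  have habs : c' ^ 2 * |w 3| = c ^ 2 * |w 3| := by
    have h := congrArg abs hdual
    rwa [abs_mul, abs_mul, abs_sq, abs_sq, hT, ← Pi.sub_apply, ← hw] at h
  exact (mul_right_cancel₀ (abs_ne_zero.2 hw3) habs).symm

end SpeedOfLight

namespace WorldviewModel

section Distance

variable {Q : Type*} [Field Q] [LinearOrder Q] {c : Q}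

theorem qsqrt_nonneg (a : Q) : 0 ≤ qsqrt a := by
  unfold qsqrt
  split_ifs with h
  · exact h.choose_spec.1
  · exact le_rfl

theorem spaceDist_nonneg (x y : Fin 4 → Q) : 0 ≤ spaceDist x y := qsqrt_nonneg _

variable [IsStrictOrderedRing Q]

theorem timeDiff_nonneg (x y : Fin 4 → Q) : 0 ≤ timeDiff x y := abs_nonneg _

theorem timeDiff_eq_zero_iff {x y : Fin 4 → Q} : timeDiff x y = 0 ↔ x 3 = y 3 := by
  rw [timeDiff, abs_eq_zero, sub_eq_zero]

theorem spaceDist_eq_mul_iff_of_nonpos (hc : c ≤ 0) (x y : Fin 4 → Q) :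
    spaceDist x y = c * timeDiff x y ↔ spaceDist x y = 0 ∧ c * timeDiff x y = 0 := by
  refine ⟨fun h => ?_, fun h => h.1.trans h.2.symm⟩
  have hdist := spaceDist_nonneg x y
  have htime := mul_nonpos_of_nonpos_of_nonneg hc (timeDiff_nonneg x y)
  exact ⟨(h.trans_le htime).antisymm hdist, htime.antisymm (h ▸ hdist)⟩

theorem qsqrt_sq (hE : ∀ a : Q, 0 < a → ∃ r : Q, a = r ^ 2) {a : Q} (ha : 0 ≤ a) :
    qsqrt a ^ 2 = a := by
  have h : ∃ r : Q, 0 ≤ r ∧ r ^ 2 = a := by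
    rcases ha.eq_or_lt with rfl | ha
    · exact ⟨0, le_rfl, by simp⟩
    · obtain ⟨r, hr⟩ := hE a ha
      exact ⟨|r|, abs_nonneg r, by rw [sq_abs, hr]⟩
  rw [qsqrt, dif_pos h]
  exact h.choose_spec.2

theorem minkowskiForm_sub_self (hE : ∀ a : Q, 0 < a → ∃ r : Q, a = r ^ 2) (c : Q)
    (x y : Fin 4 → Q) :
    minkowskiForm c (x - y) (x - y) = spaceDist x y ^ 2 - (c * timeDiff x y) ^ 2 := by
  rw [spaceDist, qsqrt_sq hE (by positivity), mul_pow, timeDiff, sq_abs, minkowskiForm_apply]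
  simp only [Pi.sub_apply]
  ring

theorem nullSep_minkowskiForm_iff (hE : ∀ a : Q, 0 < a → ∃ r : Q, a = r ^ 2) (hc : 0 ≤ c)
    (x y : Fin 4 → Q) :
    NullSep (minkowskiForm c) x y ↔ spaceDist x y = c * timeDiff x y := by
  rw [NullSep, ← neg_sub, map_neg, map_neg, LinearMap.neg_apply, neg_neg,
    minkowskiForm_sub_self hE, sub_eq_zero,
    pow_left_inj₀ (spaceDist_nonneg x y) (mul_nonneg hc (timeDiff_nonneg x y)) two_ne_zero]

theorem spaceDist_eq_zero_iff (hE : ∀ a : Q, 0 < a → ∃ r : Q, a = r ^ 2) (x y : Fin 4 → Q) :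
    spaceDist x y = 0 ↔ x 0 = y 0 ∧ x 1 = y 1 ∧ x 2 = y 2 := by
  rw [← pow_eq_zero_iff two_ne_zero, spaceDist, qsqrt_sq hE (by positivity),
    add_eq_zero_iff_of_nonneg (by positivity) (by positivity),
    add_eq_zero_iff_of_nonneg (by positivity) (by positivity)]
  simp [sub_eq_zero, and_assoc]

theorem spaceDist_eq_zero_and_timeDiff_eq_zero_iff (hE : ∀ a : Q, 0 < a → ∃ r : Q, a = r ^ 2)
    {x y : Fin 4 → Q} : spaceDist x y = 0 ∧ timeDiff x y = 0 ↔ x = y := by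
  rw [spaceDist_eq_zero_iff hE, timeDiff_eq_zero_iff, funext_iff, Fin.forall_fin_succ]
  simp [Fin.forall_fin_succ, and_assoc]

theorem spaceDist_eq_mul_iff_of_neg (hE : ∀ a : Q, 0 < a → ∃ r : Q, a = r ^ 2) (hc : c < 0)
    (x y : Fin 4 → Q) : spaceDist x y = c * timeDiff x y ↔ x = y := by
  rw [spaceDist_eq_mul_iff_of_nonpos hc.le, mul_eq_zero, or_iff_right hc.ne,
    spaceDist_eq_zero_and_timeDiff_eq_zero_iff hE]

end Distance

section LightSignals

variable {B Q : Type*} {M : WorldviewModel B Q} {i j : B} {c c' : Q}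

/-- According to `i`, some light signal passes through both coordinate points. -/
def LightConnected (M : WorldviewModel B Q) (i : B) (x y : Fin 4 → Q) : Prop :=
  ∃ p ∈ M.Ph, x ∈ M.wline i p ∧ y ∈ M.wline i p

theorem lightConnected_congr {x y x' y' : Fin 4 → Q} (hx : M.ev i x = M.ev j x')
    (hy : M.ev i y = M.ev j y') : M.LightConnected i x y ↔ M.LightConnected j x' y' := by
  have hx' : ∀ b, M.W i b x ↔ M.W j b x' := fun b => Set.ext_iff.1 hx b
  have hy' : ∀ b, M.W i b y ↔ M.W j b y' := fun b => Set.ext_iff.1 hy b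
  simp only [LightConnected, wline, Set.mem_ofPred_eq, hx', hy']

variable [Field Q] [LinearOrder Q]

theorem IsLightSpeed.lightConnected_iff (h : M.IsLightSpeed i c) (x y : Fin 4 → Q) :
    M.LightConnected i x y ↔ spaceDist x y = c * timeDiff x y := h x y

variable [IsStrictOrderedRing Q]

theorem IsLightSpeed.lightConnected_iff_nullSep (h : M.IsLightSpeed i c) (hE : M.AxEField)
    (hc : 0 ≤ c) (x y : Fin 4 → Q) :
    M.LightConnected i x y ↔ NullSep (minkowskiForm c) x y := by
  rw [h.lightConnected_iff, nullSep_minkowskiForm_iff hE hc]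

theorem IsLightSpeed.lightConnected_trans (h : M.IsLightSpeed i c) (hE : M.AxEField)
    (hc : c ≤ 0) {x y z : Fin 4 → Q} (hxy : M.LightConnected i x y)
    (hyz : M.LightConnected i y z) : M.LightConnected i x z := by
  simp only [h.lightConnected_iff, spaceDist_eq_mul_iff_of_nonpos hc, spaceDist_eq_zero_iff hE,
    mul_eq_zero, timeDiff_eq_zero_iff] at hxy hyz ⊢
  grind

theorem IsLightSpeed.exists_not_lightConnected_trans (h : M.IsLightSpeed i c) (hE : M.AxEField)
    (hc : 0 < c) :
    ∃ x y z, M.LightConnected i x y ∧ M.LightConnected i y z ∧ ¬ M.LightConnected i x z := by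
  refine ⟨0, ![c, 0, 0, 1], ![2 * c, 0, 0, 0], ?_⟩
  simp only [h.lightConnected_iff_nullSep hE hc.le, NullSep, minkowskiForm_apply]
  exact ⟨by simp [sq], by simp; ring, by simp [hc.ne']⟩

theorem IsLightSpeed.nonpos_of_nonpos (hci : M.IsLightSpeed i c) (hcj : M.IsLightSpeed j c')
    (hE : M.AxEField) (hEv : M.AxEv) (hi : i ∈ M.IOb) (hj : j ∈ M.IOb) (hc : c ≤ 0) : c' ≤ 0 := by
  by_contra! hc'
  obtain ⟨x, y, z, hxy, hyz, hxz⟩ := hcj.exists_not_lightConnected_trans hE hc'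
  obtain ⟨x', hx⟩ := hEv j hj i hi x
  obtain ⟨y', hy⟩ := hEv j hj i hi y
  obtain ⟨z', hz⟩ := hEv j hj i hi z
  rw [lightConnected_congr hx hy] at hxy
  rw [lightConnected_congr hy hz] at hyz
  rw [lightConnected_congr hx hz] at hxz
  exact hxz (hci.lightConnected_trans hE hc hxy hyz)

theorem IsLightSpeed.eq_of_lightConnected (h : M.IsLightSpeed i c) (hE : M.AxEField) (hc : c < 0)
    {x y : Fin 4 → Q} (hxy : M.LightConnected i x y) : x = y :=
  (spaceDist_eq_mul_iff_of_neg hE hc x y).1 ((h.lightConnected_iff x y).1 hxy)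

theorem AxSymTime.ev_zero_ne_ev_time (hT : M.AxSymTime) (hj : j ∈ M.IOb) :
    M.ev j 0 ≠ M.ev j ![0, 0, 0, 1] := fun h => by
  simpa [timeDiff] using hT j hj j hj 1 0 0 ![0, 0, 0, 1] 0
    (by rw [one_smul]; exact h.symm) rfl (by rw [one_smul]; rfl) rfl

theorem IsLightSpeed.neg_of_neg (hci : M.IsLightSpeed i c) (hcj : M.IsLightSpeed j c')
    (hE : M.AxEField) (hEv : M.AxEv) (hT : M.AxSymTime) (hi : i ∈ M.IOb) (hj : j ∈ M.IOb)
    (hc : c < 0) : c' < 0 := by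
  refine lt_of_le_of_ne (hci.nonpos_of_nonpos hcj hE hEv hi hj hc.le) ?_
  rintro rfl
  have hconn : M.LightConnected j 0 ![0, 0, 0, 1] := by
    rw [hcj.lightConnected_iff, zero_mul, spaceDist_eq_zero_iff hE]
    simp
  obtain ⟨x, hx⟩ := hEv j hj i hi 0
  obtain ⟨y, hy⟩ := hEv j hj i hi ![0, 0, 0, 1]
  have hxy := hci.eq_of_lightConnected hE hc ((lightConnected_congr hx hy).1 hconn)
  exact hT.ev_zero_ne_ev_time hj (hx.trans (hxy ▸ hy.symm))

theorem IsLightSpeed.ev_injective (h : M.IsLightSpeed i c) (hE : M.AxEField) (hc : 0 < c) :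
    Function.Injective (M.ev i) := fun x y hxy =>
  NullSep.eq_of_forall_iff (hasWittIndexOne_minkowskiForm hc.ne') fun z => by
    rw [← h.lightConnected_iff_nullSep hE hc.le, ← h.lightConnected_iff_nullSep hE hc.le,
      lightConnected_congr hxy rfl]

theorem IsLightSpeed.exists_nullSep_relIso (hci : M.IsLightSpeed i c) (hcj : M.IsLightSpeed j c')
    (hE : M.AxEField) (hEv : M.AxEv) (hi : i ∈ M.IOb) (hj : j ∈ M.IOb) (hc : 0 < c)
    (hc' : 0 < c') :
    ∃ f : NullSep (minkowskiForm c) ≃r NullSep (minkowskiForm c'),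
      ∀ x, M.ev i x = M.ev j (f x) := by
  choose F hF using hEv i hi j hj
  choose G hG using hEv j hj i hi
  refine ⟨{ toFun := F, invFun := G, left_inv := fun x => ?_, right_inv := fun x => ?_,
            map_rel_iff' := fun {x y} => ?_ }, hF⟩
  · exact hci.ev_injective hE hc ((hG _).symm.trans (hF x).symm)
  · exact hcj.ev_injective hE hc' ((hF _).symm.trans (hG x).symm)
  · rw [← hci.lightConnected_iff_nullSep hE hc.le, ← hcj.lightConnected_iff_nullSep hE hc'.le]
    exact (lightConnected_congr (hF x) (hF y)).symm

theorem IsLightSpeed.eq_of_pos (hci : M.IsLightSpeed i c) (hcj : M.IsLightSpeed j c')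
    (hE : M.AxEField) (hEv : M.AxEv) (hT : M.AxSymTime) (hD : M.AxSymDist)
    (hi : i ∈ M.IOb) (hj : j ∈ M.IOb) (hc : 0 < c) (hc' : 0 < c') : c = c' := by
  obtain ⟨f, hf⟩ := hci.exists_nullSep_relIso hcj hE hEv hi hj hc hc'
  have hfsymm : ∀ x, M.ev j x = M.ev i (f.symm x) := fun x => by rw [hf, f.apply_symm_apply]
  refine (pow_left_inj₀ hc.le hc'.le two_ne_zero).1
    (sq_eq_sq_of_nullSep_relIso hc.ne' hc'.ne' f (fun x hx hfx => ?_) ?_)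
  · have htime : timeDiff x 0 = 0 := timeDiff_eq_zero_iff.2 hx
    have htime' : timeDiff (f x) (f 0) = 0 := timeDiff_eq_zero_iff.2 hfx
    rw [minkowskiForm_sub_self hE, ← hD i hi j hj x 0 _ _ (hf x) (hf 0) htime htime', htime',
      ← sub_zero x, minkowskiForm_sub_self hE, sub_zero, htime, mul_zero, mul_zero]
  · exact hT i hi j hj 1 _ _ _ _ (by rw [one_smul]; exact hf _) (hf 0)
      (by rw [one_smul]; exact hfsymm _) (hfsymm 0)

theorem exists_common_lightSpeed (hPh : M.AxPh) (hE : M.AxEField) (hEv : M.AxEv)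
    (hT : M.AxSymTime) (hD : M.AxSymDist) : ∃ c : Q, ∀ i ∈ M.IOb, M.IsLightSpeed i c := by
  rcases M.IOb.eq_empty_or_nonempty with h | ⟨i, hi⟩
  · exact ⟨0, by simp [h]⟩
  obtain ⟨c, hc⟩ := hPh i hi
  refine ⟨c, fun j hj => ?_⟩
  obtain ⟨c', hc'⟩ := hPh j hj
  rcases lt_trichotomy c 0 with hneg | hzero | hpos
  · intro x y
    rw [hc' x y, spaceDist_eq_mul_iff_of_neg hE (hc.neg_of_neg hc' hE hEv hT hi hj hneg),
      spaceDist_eq_mul_iff_of_neg hE hneg]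
  · have hnonneg : ¬ c' < 0 := fun h => (hc'.neg_of_neg hc hE hEv hT hj hi h).ne hzero
    have hzero' : c' = 0 :=
      (hc.nonpos_of_nonpos hc' hE hEv hi hj hzero.le).antisymm (not_lt.1 hnonneg)
    rwa [hzero, ← hzero']
  · have hpos' : 0 < c' :=
      not_le.1 fun h => (hc'.nonpos_of_nonpos hc hE hEv hj hi h).not_gt hpos
    rwa [hc.eq_of_pos hc' hE hEv hT hD hi hj hpos hpos']

theorem IsLightSpeed.eq_of_hasSpeed (h : M.IsLightSpeed i c) (hE : M.AxEField) {p : B}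
    (hp : p ∈ M.Ph) {v : Q} (hv : M.HasSpeed i p v) : v = c := by
  obtain ⟨-, x, hx, y, hy, hxy, hdist⟩ := hv
  have htime : timeDiff x y ≠ 0 := fun ht => by
    rw [ht, mul_zero] at hdist
    exact hxy ((spaceDist_eq_zero_and_timeDiff_eq_zero_iff hE).1 ⟨hdist, ht⟩)
  exact mul_right_cancel₀ htime (hdist.symm.trans ((h x y).1 ⟨p, hp, hx, hy⟩))

end LightSignals

end WorldviewModel

theorem proposition5_general {B Q : Type*} [Field Q] [LinearOrder Q] [IsStrictOrderedRing Q]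
    (M : WorldviewModel B Q) (hPh : M.AxPh) (hE : M.AxEField) (hEv : M.AxEv)
    (hT : M.AxSymTime) (hD : M.AxSymDist) :
    M.AxLightSpeedEq ∧ ∃ c : Q, ∀ i ∈ M.IOb, M.IsLightSpeed i c := by
  obtain ⟨c, hc⟩ := WorldviewModel.exists_common_lightSpeed hPh hE hEv hT hD
  refine ⟨fun i hi j hj p hp v v' hv hv' => ?_, c, hc⟩
  rw [(hc i hi).eq_of_hasSpeed hE hp hv, (hc j hj).eq_of_hasSpeed hE hp hv']

theorem proposition5 {B Q : Type*} [Field Q] [LinearOrder Q] [IsStrictOrderedRing Q]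
    (M : WorldviewModel B Q) (h₀ : M.SpecRel₀) (hT : M.AxSymTime) (hD : M.AxSymDist) :
    M.AxLightSpeedEq ∧ ∃ c : Q, ∀ i ∈ M.IOb, M.IsLightSpeed i c :=
  proposition5_general M h₀.axPh h₀.axEField h₀.axEv hT hD
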